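/- **Corollary 1.7 (Maximum Matching, deterministic).** There are an absolute constant $C$ and a single deterministic algorithm $\mathcal A$ in the $\mathsf{LOCAL}$ model such that the following holds for all integers $\delta > r \ge 1$ and every finite simple bipartite graph $G=(L\sqcup R,F)$ with $n=|L|+|R|$ nodes in which every node of $L$ has degree at least $\delta$ and every node of $R$ has degree at most $r$. If all nodes know $n$, $\delta$ and $r$, then within at most $$C\cdot \log_{\delta/r} n$$ communication rounds of $\mathcal A$ on $G$ every node has irrevocably output one of its incident edges (the edge to its matching partner) or "unmatched", these outputs are consistent at the two endpoints of every edge, and the edges that are output form a matching $M$ of $G$ that saturates every node of $L$; in particular $M$ has the largest number of edges among all matchings of $G$. Here the $\mathsf{LOCAL}$ model is the standard one: the nodes of $G$ are computational entities with pairwise distinct identifiers in $\mathbb N$, each node numbers its incident edges by arbitrary ports, and initially a node knows only its identifier, its degree and the numbers $n,\delta,r$. Communication happens in synchronous rounds; in each round every node performs arbitrary local computation and sends one message of arbitrary size along each of its incident edges. The claim holds for every assignment of distinct identifiers and every port numbering. -/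

import Mathlib

/-- The data of a communication network on the graph `G` in the `LOCAL` model: every node numbers
its incident edges by ports `0, …, deg v - 1` (in an arbitrary way, with no relation between the
numbers at the two ends of an edge), and the nodes carry pairwise distinct identifiers. -/
structure LocalNetwork {V : Type*} (G : SimpleGraph V) [G.LocallyFinite] where
  /-- `port v i` is the neighbor of `v` at the other end of the edge at port `i` of `v`. -/
  port : ∀ v : V, Fin (G.degree v) ≃ G.neighborSet v
  /-- the unique identifiers -/
  ident : V → ℕ
  ident_injective : Function.Injective ident

/-- A deterministic (synchronous, message passing) algorithm in the `LOCAL` model, as executed by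
every node. `State d` is the type of states, and `Output d` the type of outputs, of a node of
degree `d`. Local computation is arbitrary and messages have unbounded size. -/
structure LocalAlgorithm (Input : Type) (Output : ℕ → Type) where
  State : ℕ → Type
  Message : Type
  /-- The initial state of a node; it depends only on the input, the identifier and the degree. -/
  init : Input → (ident : ℕ) → (d : ℕ) → State d
  /-- The message sent through each of the ports. -/
  send : {d : ℕ} → State d → Fin d → Message
  /-- The new state after a round, from the messages received through each of the ports. -/
  receive : {d : ℕ} → State d → (Fin d → Message) → State d
  /-- What the node has output so far: `none` means that it has not yet output anything. -/
  output : {d : ℕ} → State d → Option (Output d)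

namespace LocalAlgorithm

variable {Input : Type} {Output : ℕ → Type} {V : Type*} {G : SimpleGraph V} [G.LocallyFinite]

/-- `A.state N inp t v` is the state of the node `v` after `t` rounds of the execution of `A` on
the network `N`, where `inp` is the input given to all nodes. In each round, the node `v` receives
through its port `i`, leading to `w`, the message that `w` sends through its port leading to `v`. -/
def state (A : LocalAlgorithm Input Output) (N : LocalNetwork G) (inp : Input) :
    ℕ → (v : V) → A.State (G.degree v)
  | 0, v => A.init inp (N.ident v) (G.degree v)
  | t + 1, v =>
      A.receive (A.state N inp t v) fun i =>
        A.send (A.state N inp t (N.port v i))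
          ((N.port (N.port v i)).symm ⟨v, (N.port v i).2.symm⟩)

/-- In the execution of `A` on `N`, every node `v` outputs `out v` within the first `T` rounds.
Outputs are irrevocable: no node ever outputs anything else. -/
def OutputsWithin (A : LocalAlgorithm Input Output) (N : LocalNetwork G) (inp : Input) (T : ℕ)
    (out : (v : V) → Output (G.degree v)) : Prop :=
  ∀ v : V,
    (∀ t : ℕ, T ≤ t → A.output (A.state N inp t v) = some (out v)) ∧
    (∀ (t : ℕ) (o : Output (G.degree v)), A.output (A.state N inp t v) = some o → o = out v)

end LocalAlgorithm

/-- The global parameters known to all nodes: the number `n` of nodes of the graph, a lower bound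
`δ` on the left side degrees and an upper bound `r` on the right side degrees. -/
structure BipartiteParams where
  n : ℕ
  δ : ℕ
  r : ℕ

/-- The outputs `out` describe the matching (or, more generally, the subgraph) `M`: each node
outputs the port that leads to its partner in `M`, or `none` if it has no partner. In particular
both endpoints of every edge of `M` know that this edge is in `M`. -/
def DescribesMatching {V : Type*} {G : SimpleGraph V} [G.LocallyFinite] (N : LocalNetwork G)
    (out : (v : V) → Option (Fin (G.degree v))) (M : G.Subgraph) : Prop :=
  ∀ v w : V, M.Adj v w ↔ ∃ i : Fin (G.degree v), out v = some i ∧ (N.port v i : V) = w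

/-- `M` is a matching of `G` with the largest possible number of edges (`G` a finite graph). -/
def IsMaximumMatching {V : Type*} {G : SimpleGraph V} (M : G.Subgraph) : Prop :=
  M.IsMatching ∧ ∀ M' : G.Subgraph, M'.IsMatching → M'.edgeSet.ncard ≤ M.edgeSet.ncard

/-! Call a set `U` of right nodes absorbing if all its neighbors can be matched injectively into
`U`. Every left node `w` is adjacent to an absorbing set inside the ball of radius `2 * k` around
`w`, where `(δ / r) ^ k > n` (`exists_absorbs_near`). Indeed, take a largest absorbing `U` in the
ball and suppose that it misses `w`. Grow layers of left nodes outside `nbrs U`, starting from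
`{w}`. By double counting, a layer `S` has at least `|S| * δ / r` neighbors. If these had no more
neighbors outside `nbrs U` than their own number, a minimal such subset would satisfy Hall's
condition and could be added to `U`. So the layers grow by a factor `δ / r`, and the `k`-th one
would exceed `n`.

This makes the problem local. Each node collects its ball, proposes one such plan if it exists, and
each left node follows the plan of smallest center covering it. No conflicts arise: a plan using a
right node `u` covers all neighbors of `u`, so two left nodes sent to `u` see each other's plans and
follow the same one (`Matched.left_unique`), and a plan is injective. A matching saturating `L` is
maximum, since each edge uses a node of `L`. -/

namespace SimpleGraph

variable {V : Type*} (G : SimpleGraph V)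

/-! ### Balls in a graph -/

/-- `x` can be reached from `v` by at most `j` steps. -/
def Near (j : ℕ) (v x : V) : Prop := ∃ p : G.Walk v x, p.length ≤ j

variable {G}

theorem Near.refl (j : ℕ) (v : V) : G.Near j v v := ⟨.nil, Nat.zero_le _⟩

theorem Near.mono {i j : ℕ} (h : i ≤ j) {v x : V} : G.Near i v x → G.Near j v x :=
  fun ⟨p, hp⟩ => ⟨p, hp.trans h⟩

theorem Near.symm {j : ℕ} {v x : V} : G.Near j v x → G.Near j x v :=
  fun ⟨p, hp⟩ => ⟨p.reverse, by simpa using hp⟩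

theorem Near.cons {j : ℕ} {u v x : V} (h : G.Adj u v) : G.Near j v x → G.Near (j + 1) u x :=
  fun ⟨p, hp⟩ => ⟨.cons h p, by simpa using hp⟩

theorem Near.concat {j : ℕ} {u v x : V} (h : G.Near j u v) (hvx : G.Adj v x) :
    G.Near (j + 1) u x :=
  (h.symm.cons hvx.symm).symm

theorem near_zero {v x : V} : G.Near 0 v x ↔ x = v := by
  constructor
  · rintro ⟨p, hp⟩
    exact (Walk.eq_of_length_eq_zero (Nat.le_zero.mp hp)).symm
  · rintro rfl
    exact Near.refl _ _

theorem near_succ {j : ℕ} {v x : V} :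
    G.Near (j + 1) v x ↔ G.Near j v x ∨ ∃ y, G.Adj v y ∧ G.Near j y x := by
  constructor
  · rintro ⟨p, hp⟩
    cases p with
    | nil => exact .inl (Near.refl _ _)
    | cons h q => exact .inr ⟨_, h, q, by simpa using hp⟩
  · rintro (h | ⟨y, hy, h⟩)
    · exact h.mono (Nat.le_succ _)
    · exact h.cons hy

/-! ### Absorbing sets and Hall's theorem -/

section Hall

variable [DecidableEq V] [G.LocallyFinite]

variable (G) in
/-- The set of all neighbors of nodes of `U`. -/
def nbrs (U : Finset V) : Finset V := U.biUnion fun u => G.neighborFinset u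

theorem mem_nbrs {U : Finset V} {a : V} : a ∈ G.nbrs U ↔ ∃ u ∈ U, G.Adj u a := by
  simp [nbrs]

theorem nbrs_mono {U U' : Finset V} (h : U ⊆ U') : G.nbrs U ⊆ G.nbrs U' :=
  Finset.biUnion_subset_biUnion_of_subset_left _ h

variable (G) in
/-- The neighbors of `U` outside of `Z` can be matched into `U`. -/
def Absorbs (U Z : Finset V) : Prop :=
  ∃ f : V → V, Set.InjOn f (G.nbrs U \ Z : Finset V) ∧
    ∀ a ∈ G.nbrs U \ Z, f a ∈ U ∧ G.Adj a (f a)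

/-- Neighbors of `U'` keep their mates in `U'`, the remaining ones use `U`; disjointness of `U` and
`U'` prevents collisions. -/
theorem Absorbs.union {U U' : Finset V} (h' : G.Absorbs U' ∅) (h : G.Absorbs U (G.nbrs U'))
    (hd : Disjoint U U') : G.Absorbs (U ∪ U') ∅ := by
  obtain ⟨f', hf', hm'⟩ := h'
  obtain ⟨f, hf, hm⟩ := h
  simp only [Finset.sdiff_empty] at hf' hm'
  have key : ∀ a ∈ G.nbrs (U ∪ U'), a ∉ G.nbrs U' → a ∈ G.nbrs U \ G.nbrs U' := by
    intro a ha hna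
    simp only [nbrs, Finset.union_biUnion, Finset.mem_union, Finset.mem_sdiff] at ha hna ⊢
    tauto
  refine ⟨fun a => if a ∈ G.nbrs U' then f' a else f a, ?_, ?_⟩
  · intro a ha b hb hab
    simp only [Finset.sdiff_empty, Finset.mem_coe] at ha hb
    by_cases h1 : a ∈ G.nbrs U' <;> by_cases h2 : b ∈ G.nbrs U' <;>
      simp only [h1, h2, if_true, if_false] at hab
    · exact hf' h1 h2 hab
    · exact absurd (hm' a h1).1 (Finset.disjoint_left.mp hd (hab ▸ (hm b (key b hb h2)).1))
    · exact absurd (hm' b h2).1 (Finset.disjoint_left.mp hd (hab ▸ (hm a (key a ha h1)).1))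
    · exact hf (key a ha h1) (key b hb h2) hab
  · intro a ha
    rw [Finset.sdiff_empty] at ha
    by_cases h1 : a ∈ G.nbrs U' <;> simp only [h1, if_true, if_false]
    · exact ⟨Finset.mem_union_right _ (hm' a h1).1, (hm' a h1).2⟩
    · exact ⟨Finset.mem_union_left _ (hm a (key a ha h1)).1, (hm a (key a ha h1)).2⟩

/-- A minimal nonempty set `U` with at most `|U|` neighbors outside of `Z` absorbs them. -/
theorem absorbs_of_minimal {U Z : Finset V} (hU : (G.nbrs U \ Z).card ≤ U.card)
    (hmin : ∀ U' ⊆ U, U'.Nonempty → (G.nbrs U' \ Z).card ≤ U'.card → U' = U) :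
    G.Absorbs U Z := by
  set S := G.nbrs U \ Z with hS
  have hall : ∀ s : Finset S, s.card ≤ (s.biUnion fun a => G.neighborFinset a ∩ U).card := by
    intro s
    by_contra! hlt
    set W := s.biUnion fun a => G.neighborFinset a ∩ U with hW
    set s' : Finset V := s.map (Function.Embedding.subtype _) with hs'
    have hs'c : s'.card = s.card := Finset.card_map _
    have hs'S : s' ⊆ S := by
      intro a ha
      obtain ⟨b, -, rfl⟩ := Finset.mem_map.mp ha
      exact b.2
    have hWU : W ⊆ U := Finset.biUnion_subset.mpr fun _ _ => Finset.inter_subset_right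
    -- If `s` violates Hall's condition, removing `W` from `U` loses all of `s'` as neighbors, and
    -- `|W| < |s'|`. So `U \ W` still meets the bound, and minimality forces `W` to be empty,
    -- although elements of `s` have neighbors in `U`.
    have hsub : G.nbrs (U \ W) \ Z ⊆ S \ s' := by
      intro a ha
      obtain ⟨ha1, ha2⟩ := Finset.mem_sdiff.mp ha
      refine Finset.mem_sdiff.mpr
        ⟨Finset.mem_sdiff.mpr ⟨nbrs_mono Finset.sdiff_subset ha1, ha2⟩, fun has => ?_⟩
      obtain ⟨b, hb, rfl⟩ := Finset.mem_map.mp has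
      obtain ⟨u, hu, hub⟩ := mem_nbrs.mp ha1
      obtain ⟨hu1, hu2⟩ := Finset.mem_sdiff.mp hu
      exact hu2 (Finset.mem_biUnion.mpr ⟨b, hb, by simpa [hu1] using hub.symm⟩)
    have h1 := Finset.card_le_card hsub
    have h2 := Finset.card_sdiff_add_card_eq_card hs'S
    have h3 := Finset.card_sdiff_add_card_eq_card hWU
    have hEq := hmin (U \ W) Finset.sdiff_subset (Finset.card_pos.mp (by omega)) (by omega)
    obtain ⟨b, hb⟩ : s.Nonempty := Finset.card_pos.mp (by omega)
    obtain ⟨u, hu, hub⟩ := mem_nbrs.mp (Finset.mem_sdiff.mp b.2).1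
    have hu' := hu
    rw [← hEq] at hu'
    exact (Finset.mem_sdiff.mp hu').2
      (Finset.mem_biUnion.mpr ⟨b, hb, by simpa [hu] using hub.symm⟩)
  obtain ⟨g, hg, hgm⟩ := (Finset.all_card_le_biUnion_card_iff_exists_injective _).mp hall
  refine ⟨fun a => if h : a ∈ S then g ⟨a, h⟩ else a, ?_, ?_⟩
  · intro a ha b hb hab
    replace ha : a ∈ S := ha
    replace hb : b ∈ S := hb
    simp only [ha, hb, dif_pos] at hab
    simpa using hg hab
  · intro a ha
    replace ha : a ∈ S := ha
    have := hgm ⟨a, ha⟩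
    simp only [Finset.mem_inter, mem_neighborFinset] at this
    simp only [ha, dif_pos]
    exact this.symm

theorem exists_absorbs_subset {U Z : Finset V} (hne : U.Nonempty)
    (hU : (G.nbrs U \ Z).card ≤ U.card) :
    ∃ U' ⊆ U, U'.Nonempty ∧ G.Absorbs U' Z := by
  induction hn : U.card using Nat.strong_induction_on generalizing U with
  | _ m ih =>
    by_cases h : ∃ U' ⊂ U, U'.Nonempty ∧ (G.nbrs U' \ Z).card ≤ U'.card
    · obtain ⟨U', hss, hne', hU'⟩ := h
      obtain ⟨U'', h1, h2⟩ := ih _ (hn ▸ Finset.card_lt_card hss) hne' hU' rfl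
      exact ⟨U'', h1.trans hss.subset, h2⟩
    · push Not at h
      refine ⟨U, subset_rfl, hne, absorbs_of_minimal hU fun U' hs hne' hU' => ?_⟩
      by_contra hcon
      exact absurd (h U' (hs.ssubset_of_ne hcon) hne') (not_lt.mpr hU')

/-! ### Expansion and absorbing sets in small balls -/

variable {L R : Set V} {δ r : ℕ}

/-- Double counting of the edges between `S` and its neighbors. -/
theorem IsBipartiteWith.mul_card_le_mul_card_nbrs (hG : G.IsBipartiteWith L R)
    (hL : ∀ v ∈ L, δ ≤ G.degree v) (hR : ∀ v ∈ R, G.degree v ≤ r) {S : Finset V}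
    (hS : ∀ a ∈ S, a ∈ L) : S.card * δ ≤ (G.nbrs S).card * r := by
  classical
  refine Finset.card_mul_le_card_mul G.Adj (fun a ha => ?_) fun b hb => ?_
  · refine (hL a (hS a ha)).trans (Finset.card_le_card fun u hu => ?_)
    rw [mem_neighborFinset] at hu
    simp only [Finset.mem_bipartiteAbove]
    exact ⟨mem_nbrs.mpr ⟨a, ha, hu⟩, hu⟩
  · obtain ⟨a, ha, hab⟩ := mem_nbrs.mp hb
    refine (Finset.card_le_card fun u hu => ?_).trans (hR b (hG.mem_of_mem_adj (hS a ha) hab))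
    simp only [Finset.mem_bipartiteBelow] at hu
    exact (mem_neighborFinset _ _ _).mpr hu.2.symm

/-- Every node on the left is adjacent to a set of nodes on the right that lies in a small ball
and absorbs all of its neighbors. -/
theorem IsBipartiteWith.exists_absorbs_near [Fintype V] (hG : G.IsBipartiteWith L R)
    (hL : ∀ v ∈ L, δ ≤ G.degree v) (hR : ∀ v ∈ R, G.degree v ≤ r) (hδ : 0 < δ) {k : ℕ}
    (hk : Fintype.card V * r ^ k < δ ^ k) {w : V} (hw : w ∈ L) :
    ∃ U : Finset V, (∀ u ∈ U, u ∈ R ∧ G.Near (2 * k) w u) ∧ w ∈ G.nbrs U ∧ G.Absorbs U ∅ := by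
  classical
  let fam : Finset (Finset V) :=
    Finset.univ.filter fun U => (∀ u ∈ U, u ∈ R ∧ G.Near (2 * k) w u) ∧ G.Absorbs U ∅
  have hfam : fam.Nonempty := ⟨∅, by simp [fam, Absorbs, nbrs, isEmpty_or_nonempty]⟩
  obtain ⟨U, hU, hmax⟩ := fam.exists_max_image Finset.card hfam
  simp only [fam, Finset.mem_filter, Finset.mem_univ, true_and] at hU hmax
  refine ⟨U, hU.1, ?_, hU.2⟩
  by_contra hwU
  -- The layers of left nodes not covered by `U`; the bound `|S| ≥ (δ / r) ^ i` is stated without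
  -- division.
  have hgrow : ∀ i ≤ k, ∃ S : Finset V,
      (∀ a ∈ S, a ∈ L ∧ a ∉ G.nbrs U ∧ G.Near (2 * i) w a) ∧ δ ^ i ≤ S.card * r ^ i := by
    intro i
    induction i with
    | zero => exact fun _ => ⟨{w}, by simp [hw, hwU, Near.refl], by simp⟩
    | succ i ih =>
      intro hi
      obtain ⟨S, hS, hcard⟩ := ih (by omega)
      have hcount := hG.mul_card_le_mul_card_nbrs hL hR fun a ha => (hS a ha).1
      have hnear : ∀ u ∈ G.nbrs S, u ∈ R ∧ G.Near (2 * i + 1) w u ∧ u ∉ U := by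
        intro u hu
        obtain ⟨a, ha, hau⟩ := mem_nbrs.mp hu
        obtain ⟨h1, h2, h3⟩ := hS a ha
        exact ⟨hG.mem_of_mem_adj h1 hau, h3.concat hau,
          fun huU => h2 (mem_nbrs.mpr ⟨u, huU, hau.symm⟩)⟩
      refine ⟨G.nbrs (G.nbrs S) \ G.nbrs U, fun b hb => ?_, ?_⟩
      · obtain ⟨hb1, hb2⟩ := Finset.mem_sdiff.mp hb
        obtain ⟨u, hu, hub⟩ := mem_nbrs.mp hb1
        obtain ⟨h1, h2, -⟩ := hnear u hu
        exact ⟨hG.symm.mem_of_mem_adj h1 hub, hb2, h2.concat hub⟩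
      -- Without growth, part of `nbrs S` absorbs its neighbors outside `nbrs U` and enlarges the
      -- maximal `U`. It is at distance at most `2 * i + 1 ≤ 2 * k`, so it stays in the ball.
      · by_cases ht : (G.nbrs (G.nbrs S) \ G.nbrs U).card ≤ (G.nbrs S).card
        · exfalso
          have hne : (G.nbrs S).Nonempty := by
            rw [← Finset.card_pos]
            by_contra h0
            have h0 : (G.nbrs S).card = 0 := by omega
            have hS0 : 0 < S.card := by
              by_contra h
              have : S.card = 0 := by omega
              rw [this, zero_mul] at hcard
              exact absurd hcard (not_le.mpr (pow_pos hδ i))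
            rw [h0, zero_mul] at hcount
            exact absurd hcount (not_le.mpr (Nat.mul_pos hS0 hδ))
          obtain ⟨U', hU'S, hU'ne, hU'⟩ := exists_absorbs_subset hne ht
          have hd : Disjoint U' U :=
            Finset.disjoint_left.mpr fun u hu => (hnear u (hU'S hu)).2.2
          have h1 := hmax (U' ∪ U) ⟨fun u hu => ?_, hU.2.union hU' hd⟩
          · rw [Finset.card_union_of_disjoint hd] at h1
            have := hU'ne.card_pos
            omega
          · rcases Finset.mem_union.mp hu with hu | hu
            · have := hnear u (hU'S hu)
              exact ⟨this.1, this.2.1.mono (by omega)⟩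
            · exact hU.1 u hu
        · calc δ ^ (i + 1) = δ ^ i * δ := pow_succ _ _
            _ ≤ S.card * r ^ i * δ := Nat.mul_le_mul_right _ hcard
            _ = S.card * δ * r ^ i := by ring
            _ ≤ (G.nbrs S).card * r * r ^ i := Nat.mul_le_mul_right _ hcount
            _ = (G.nbrs S).card * r ^ (i + 1) := by ring
            _ ≤ _ := Nat.mul_le_mul_right _ (by omega)
  obtain ⟨S, -, hS⟩ := hgrow k le_rfl
  exact absurd (hS.trans (Nat.mul_le_mul_right _ (Finset.card_le_univ S))) (not_le.mpr hk)

end Hall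

/-! ### Matching size versus the size of `L` -/

theorem Subgraph.ncard_edgeSet_le [Finite V] {L R : Set V} (hG : G.IsBipartiteWith L R)
    {M : G.Subgraph} (hM : M.IsMatching) : M.edgeSet.ncard ≤ L.ncard := by
  classical
  -- Each matching edge is the edge at its left endpoint; the diagonal value for unmatched nodes is
  -- junk.
  have hsub : M.edgeSet ⊆
      (fun v => if h : ∃ w, M.Adj v w then s(v, h.choose) else s(v, v)) '' L := by
    intro e he
    have key : ∀ a b, a ∈ L → M.Adj a b →
        s(a, b) ∈ (fun v => if h : ∃ w, M.Adj v w then s(v, h.choose) else s(v, v)) '' L := by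
      intro a b ha hab
      have h : ∃ w, M.Adj a w := ⟨b, hab⟩
      refine ⟨a, ha, ?_⟩
      simp only [h, dif_pos]
      rw [(hM (M.edge_vert hab)).unique h.choose_spec hab]
    induction e with
    | _ a b =>
      rw [Subgraph.mem_edgeSet] at he
      rcases hG.mem_of_adj he.adj_sub with h | h
      · exact key a b h.1 he
      · rw [Sym2.eq_swap]
        exact key b a h.2 he.symm
  exact (Set.ncard_le_ncard hsub (Set.toFinite _)).trans (Set.ncard_image_le (Set.toFinite _))

theorem Subgraph.le_ncard_edgeSet [Finite V] {L R : Set V} (hG : G.IsBipartiteWith L R)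
    {M : G.Subgraph} {f : V → V} (hf : ∀ v ∈ L, M.Adj v (f v)) : L.ncard ≤ M.edgeSet.ncard := by
  refine Set.ncard_le_ncard_of_injOn (fun v => s(v, f v)) (fun v hv => hf v hv) ?_ (Set.toFinite _)
  intro a ha b hb hab
  rcases Sym2.eq_iff.mp hab with h | h
  · exact h.1
  · exact absurd (h.1 ▸ hG.mem_of_mem_adj hb (hf b hb).adj_sub)
      (Set.disjoint_left.mp hG.disjoint ha)

end SimpleGraph

/-! ### Matching plans and the algorithm -/

open SimpleGraph

/-- What a node knows about the surroundings of a node: its identifier and those of its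
neighbors. -/
abbrev LocalFact : Type := ℕ × Finset ℕ

/-- A partial matching of identifiers, proposed by the node with identifier `center`; it matches
every `x ∈ left` to `mate x ∈ right`. -/
structure MatchingPlan where
  center : ℕ
  left : Set ℕ
  right : Set ℕ
  mate : ℕ → ℕ

namespace MatchingPlan

instance : Nonempty MatchingPlan := ⟨⟨0, ∅, ∅, id⟩⟩

/-- According to the facts `E`, the plan `c` saturates all neighbors of `c.right`, and it contains
its center `a`. -/
structure IsValid (r : ℕ) (E : Set LocalFact) (a : ℕ) (c : MatchingPlan) : Prop where
  center_eq : c.center = a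
  center_mem : a ∈ c.left
  closed : ∀ u ∈ c.right, ∃ S, (u, S) ∈ E ∧ S.card ≤ r ∧ ∀ x ∈ S, x ∈ c.left
  mate_mem : ∀ x ∈ c.left, c.mate x ∈ c.right ∧ ∃ S, (c.mate x, S) ∈ E ∧ x ∈ S
  injOn : Set.InjOn c.mate c.left

/-- The plan that the node with identifier `a` proposes on the basis of the facts `E`; the set is
empty if there is no valid plan. -/
def proposal (r : ℕ) (E : Set LocalFact) (a : ℕ) : Set MatchingPlan :=
  {c | c.IsValid r E a ∧ c = Classical.epsilon (IsValid r E a)}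

/-- Among the plans `X` that cover `x`, the one with the smallest center matches `x` to `y`. -/
def Assigns (X : Set MatchingPlan) (x y : ℕ) : Prop :=
  ∃ c ∈ X, x ∈ c.left ∧ c.mate x = y ∧ ∀ c' ∈ X, x ∈ c'.left → c.center ≤ c'.center

theorem Assigns.congr {X Y : Set MatchingPlan} {x y : ℕ}
    (h : ∀ c : MatchingPlan, x ∈ c.left → (c ∈ X ↔ c ∈ Y)) : Assigns X x y ↔ Assigns Y x y := by
  unfold Assigns
  constructor
  · rintro ⟨c, hc, hx, hy, hm⟩
    exact ⟨c, (h c hx).1 hc, hx, hy, fun c' hc' hx' => hm c' ((h c' hx').2 hc') hx'⟩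
  · rintro ⟨c, hc, hx, hy, hm⟩
    exact ⟨c, (h c hx).2 hc, hx, hy, fun c' hc' hx' => hm c' ((h c' hx').1 hc') hx'⟩

end MatchingPlan

open MatchingPlan

namespace BipartiteParams

/-- The radius of the ball in which a node looks for a matching plan. -/
noncomputable def radius (p : BipartiteParams) : ℕ :=
  2 * (⌊Real.logb ((p.δ : ℝ) / (p.r : ℝ)) (p.n : ℝ)⌋₊ + 1)

/-- The number of rounds of the matching algorithm. If `n ≤ δ`, then there are no nodes on the left
side and nothing has to be done. -/
noncomputable def rounds (p : BipartiteParams) : ℕ :=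
  if p.n ≤ p.δ then 0 else 2 * p.radius + 3

end BipartiteParams

/-- The state of a node in the matching algorithm. -/
structure MatchingState (d : ℕ) where
  params : BipartiteParams
  ident : ℕ
  clock : ℕ
  nbrIdent : Fin d → ℕ
  facts : Set LocalFact
  plans : Set MatchingPlan

namespace MatchingState

variable {d : ℕ}

/-- The port leading to the partner in the matching, if there is one. -/
noncomputable def partner (s : MatchingState d) : Option (Fin d) :=
  open Classical in
  if h : ∃ i, Assigns s.plans s.ident (s.nbrIdent i) ∨ Assigns s.plans (s.nbrIdent i) s.ident then
    some h.choose
  else none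

/-- The facts known after the next round, given the messages of the round. -/
noncomputable def newFacts (s : MatchingState d)
    (m : Fin d → ℕ × Set LocalFact × Set MatchingPlan) : Set LocalFact :=
  if s.clock = 0 then {(s.ident, Finset.univ.image fun i => (m i).1)}
  else s.facts ∪ ⋃ i, (m i).2.1

/-- The plans known after the next round, given the messages of the round. -/
noncomputable def newPlans (s : MatchingState d)
    (m : Fin d → ℕ × Set LocalFact × Set MatchingPlan) : Set MatchingPlan :=
  if s.clock < s.params.radius then ∅
  else if s.clock = s.params.radius then proposal s.params.r (s.newFacts m) s.ident
  else s.plans ∪ ⋃ i, (m i).2.2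

end MatchingState

/-- Every node first gathers the facts about a ball around itself, then proposes a matching plan
inside of this ball, and then learns all plans that affect itself or its neighbors. -/
noncomputable def matchingAlgorithm : LocalAlgorithm BipartiteParams (fun d => Option (Fin d)) where
  State := MatchingState
  Message := ℕ × Set LocalFact × Set MatchingPlan
  init p a _ := ⟨p, a, 0, fun _ => 0, ∅, ∅⟩
  send s _ := (s.ident, s.facts, s.plans)
  receive s m :=
    if s.params.rounds ≤ s.clock then s
    else ⟨s.params, s.ident, s.clock + 1, fun i => (m i).1, s.newFacts m, s.newPlans m⟩
  output s := if s.params.rounds ≤ s.clock then some s.partner else none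

/-! ### What the nodes know after each round -/

namespace LocalNetwork

variable {V : Type*} {G : SimpleGraph V} [G.LocallyFinite] (N : LocalNetwork G)

/-- The true fact about the node `x`. -/
def fact (x : V) : LocalFact :=
  (N.ident x, Finset.univ.image fun i => N.ident (N.port x i))

/-- The facts about the nodes in a ball. -/
def ballFacts (j : ℕ) (v : V) : Set LocalFact := {f | ∃ x, G.Near j v x ∧ f = N.fact x}

/-- The plans of the nodes in a ball. -/
def ballPlans (r D j : ℕ) (v : V) : Set MatchingPlan :=
  {c | ∃ x, G.Near j v x ∧ c ∈ proposal r (N.ballFacts D x) (N.ident x)}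

theorem exists_port_iff {v : V} {P : V → Prop} :
    (∃ i, P (N.port v i)) ↔ ∃ y, G.Adj v y ∧ P y := by
  constructor
  · rintro ⟨i, hi⟩
    exact ⟨_, (N.port v i).2, hi⟩
  · rintro ⟨y, hy, h⟩
    exact ⟨(N.port v).symm ⟨y, hy⟩, by simpa using h⟩

theorem mem_fact_snd {x : V} {a : ℕ} : a ∈ (N.fact x).2 ↔ ∃ y, G.Adj x y ∧ N.ident y = a := by
  simp only [fact, Finset.mem_image, Finset.mem_univ, true_and]
  exact N.exists_port_iff (P := fun y => N.ident y = a)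

theorem card_fact_snd (x : V) : (N.fact x).2.card = G.degree x := by
  rw [fact, Finset.card_image_of_injective, Finset.card_univ, Fintype.card_fin]
  exact fun i j h => (N.port x).injective (Subtype.ext (N.ident_injective h))

theorem ballFacts_zero (v : V) : N.ballFacts 0 v = {N.fact v} := by
  ext f
  simp [ballFacts, near_zero]

theorem ballFacts_succ (j : ℕ) (v : V) :
    N.ballFacts (j + 1) v = N.ballFacts j v ∪ ⋃ i, N.ballFacts j (N.port v i) := by
  ext f
  simp only [ballFacts, near_succ, Set.mem_ofPred_eq, Set.mem_union, Set.mem_iUnion]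
  rw [N.exists_port_iff (P := fun y => ∃ x, G.Near j y x ∧ f = N.fact x)]
  grind

theorem ballPlans_zero (r D : ℕ) (v : V) :
    N.ballPlans r D 0 v = proposal r (N.ballFacts D v) (N.ident v) := by
  ext f
  simp [ballPlans, near_zero]

theorem ballPlans_succ (r D j : ℕ) (v : V) :
    N.ballPlans r D (j + 1) v = N.ballPlans r D j v ∪ ⋃ i, N.ballPlans r D j (N.port v i) := by
  ext c
  simp only [ballPlans, near_succ, Set.mem_ofPred_eq, Set.mem_union, Set.mem_iUnion]
  rw [N.exists_port_iff
    (P := fun y => ∃ x, G.Near j y x ∧ c ∈ proposal r (N.ballFacts D x) (N.ident x))]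
  grind

/-- The state of `v` after `t` rounds of the matching algorithm. -/
noncomputable abbrev matchingState (p : BipartiteParams) (t : ℕ) (v : V) :
    MatchingState (G.degree v) :=
  matchingAlgorithm.state N p t v

/-- The messages that `v` receives in round `t + 1` of the matching algorithm. -/
noncomputable def inbox (p : BipartiteParams) (t : ℕ) (v : V) (i : Fin (G.degree v)) :
    ℕ × Set LocalFact × Set MatchingPlan :=
  let s := N.matchingState p t (N.port v i)
  (s.ident, s.facts, s.plans)

theorem matchingState_succ (p : BipartiteParams) (t : ℕ) (v : V) :
    N.matchingState p (t + 1) v =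
      let s := N.matchingState p t v
      if s.params.rounds ≤ s.clock then s
      else ⟨s.params, s.ident, s.clock + 1, fun i => (N.inbox p t v i).1,
        s.newFacts (N.inbox p t v), s.newPlans (N.inbox p t v)⟩ :=
  rfl

theorem matchingState_basic (p : BipartiteParams) (t : ℕ) (v : V) :
    (N.matchingState p t v).params = p ∧ (N.matchingState p t v).ident = N.ident v ∧
      (N.matchingState p t v).clock = min t p.rounds := by
  induction t with
  | zero => exact ⟨rfl, rfl, (Nat.zero_min _).symm⟩
  | succ t ih =>
    obtain ⟨h1, h2, h3⟩ := ih
    rw [matchingState_succ]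
    dsimp only
    rw [h1]
    split_ifs with h
    · exact ⟨h1, h2, by omega⟩
    · exact ⟨rfl, h2, by dsimp only; omega⟩

theorem matchingState_params (p : BipartiteParams) (t : ℕ) (v : V) :
    (N.matchingState p t v).params = p := (N.matchingState_basic p t v).1

theorem matchingState_ident (p : BipartiteParams) (t : ℕ) (v : V) :
    (N.matchingState p t v).ident = N.ident v := (N.matchingState_basic p t v).2.1

theorem matchingState_clock (p : BipartiteParams) (t : ℕ) (v : V) :
    (N.matchingState p t v).clock = min t p.rounds := (N.matchingState_basic p t v).2.2

theorem matchingState_of_le {p : BipartiteParams} {t : ℕ} (ht : p.rounds ≤ t) (v : V) :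
    N.matchingState p t v = N.matchingState p p.rounds v := by
  induction t, ht using Nat.le_induction with
  | base => rfl
  | succ t ht ih =>
    rw [matchingState_succ, ← ih]
    dsimp only
    rw [matchingState_params, matchingState_clock, if_pos (by omega)]

theorem matchingState_succ_of_lt {p : BipartiteParams} {t : ℕ} (ht : t < p.rounds) (v : V) :
    N.matchingState p (t + 1) v =
      let s := N.matchingState p t v
      ⟨p, N.ident v, t + 1, fun i => N.ident (N.port v i),
        s.newFacts (N.inbox p t v), s.newPlans (N.inbox p t v)⟩ := by
  rw [matchingState_succ]
  dsimp only
  rw [matchingState_params, matchingState_clock, if_neg (by omega), matchingState_ident,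
    min_eq_left ht.le]
  simp only [inbox, matchingState_ident]

theorem nbrIdent_matchingState {p : BipartiteParams} {t : ℕ} (ht : t < p.rounds) (v : V)
    (i : Fin (G.degree v)) :
    (N.matchingState p (t + 1) v).nbrIdent i = N.ident (N.port v i) := by
  rw [N.matchingState_succ_of_lt ht]

/-- Time is one ahead of the radius because the first round only reveals the neighbors' identifiers.
-/
theorem facts_matchingState {p : BipartiteParams} {j : ℕ} (hj : j < p.rounds) (v : V) :
    (N.matchingState p (j + 1) v).facts = N.ballFacts j v := by
  induction j generalizing v with
  | zero =>
    rw [N.matchingState_succ_of_lt hj, ballFacts_zero]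
    simp [MatchingState.newFacts, matchingState_clock, matchingState_ident, inbox, fact]
  | succ j ih =>
    rw [N.matchingState_succ_of_lt hj, ballFacts_succ]
    have h := ih (by omega)
    simp only [MatchingState.newFacts, matchingState_clock, inbox]
    rw [if_neg (by omega), h]
    simp only [h]

theorem plans_matchingState {p : BipartiteParams} {j : ℕ} (hj : p.radius + j < p.rounds) (v : V) :
    (N.matchingState p (p.radius + j + 1) v).plans = N.ballPlans p.r p.radius j v := by
  induction j generalizing v with
  | zero =>
    have hf := N.facts_matchingState hj v
    rw [N.matchingState_succ_of_lt hj] at hf ⊢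
    dsimp only at hf ⊢
    rw [MatchingState.newPlans, ballPlans_zero, hf, matchingState_clock, matchingState_params,
      matchingState_ident, if_neg (by omega), if_pos (by omega)]
    rfl
  | succ j ih =>
    have h := ih (by omega)
    rw [N.matchingState_succ_of_lt hj, ballPlans_succ]
    dsimp only
    rw [MatchingState.newPlans, matchingState_clock, matchingState_params,
      if_neg (by omega), if_neg (by omega)]
    simp only [inbox, ← add_assoc, h]

theorem outputsWithin_matchingAlgorithm (p : BipartiteParams) :
    matchingAlgorithm.OutputsWithin N p p.rounds
      fun v => (N.matchingState p p.rounds v).partner := by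
  have key : ∀ t v, matchingAlgorithm.output (matchingAlgorithm.state N p t v) =
      if p.rounds ≤ t then some (N.matchingState p p.rounds v).partner else none := by
    intro t v
    change (if (N.matchingState p t v).params.rounds ≤ (N.matchingState p t v).clock then
      some (N.matchingState p t v).partner else none) = _
    rw [matchingState_params, matchingState_clock]
    by_cases h : p.rounds ≤ t
    · rw [if_pos (by omega), if_pos h, N.matchingState_of_le h]
    · rw [if_neg (by omega), if_neg h]
  refine fun v => ⟨fun t ht => by rw [key, if_pos ht], fun t o ho => ?_⟩
  rw [key] at ho
  split_ifs at ho
  exact (Option.some.inj ho).symm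

end LocalNetwork

/-! ### Valid plans, translated from identifiers to nodes -/

namespace MatchingPlan.IsValid

variable {V : Type*} {G : SimpleGraph V} [G.LocallyFinite] {N : LocalNetwork G} {r D a : ℕ} {x : V}
  {c : MatchingPlan}

theorem exists_of_mem_right (hc : c.IsValid r (N.ballFacts D x) a) {u : ℕ} (hu : u ∈ c.right) :
    ∃ y, N.ident y = u ∧ G.Near D x y ∧ G.degree y ≤ r ∧ ∀ z, G.Adj y z → N.ident z ∈ c.left := by
  obtain ⟨S, ⟨y, hy, h⟩, hS, hcl⟩ := hc.closed u hu
  obtain ⟨rfl, rfl⟩ := Prod.ext_iff.mp h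
  exact ⟨y, rfl, hy, by simpa only [N.card_fact_snd] using hS,
    fun z hz => hcl _ (N.mem_fact_snd.mpr ⟨z, hz, rfl⟩)⟩

theorem exists_mate (hc : c.IsValid r (N.ballFacts D x) a) {v : V} (hv : N.ident v ∈ c.left) :
    ∃ y, c.mate (N.ident v) = N.ident y ∧ G.Near D x y ∧ G.Adj v y ∧ N.ident y ∈ c.right ∧
      G.degree y ≤ r := by
  obtain ⟨hm, S, ⟨y, hy, h⟩, hS⟩ := hc.mate_mem _ hv
  obtain ⟨h1, rfl⟩ := Prod.ext_iff.mp h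
  obtain ⟨z, hz, hzv⟩ := N.mem_fact_snd.mp hS
  obtain rfl := N.ident_injective hzv
  change c.mate (N.ident z) = N.ident y at h1
  rw [h1] at hm
  obtain ⟨y', hy', -, hd, -⟩ := hc.exists_of_mem_right hm
  obtain rfl := N.ident_injective hy'
  exact ⟨y', h1, hy, hz.symm, hm, hd⟩

theorem near_of_mem_left (hc : c.IsValid r (N.ballFacts D x) a) {v : V}
    (hv : N.ident v ∈ c.left) : G.Near (D + 1) v x := by
  obtain ⟨y, -, hy, hvy, -⟩ := hc.exists_mate hv
  exact (hy.concat hvy.symm).symm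

end MatchingPlan.IsValid

/-! ### Choice of the radius and the round bound -/

namespace BipartiteParams

theorem card_mul_pow_radius {n δ r k : ℕ} (hr : 0 < r) (hrδ : r < δ) (hn : 0 < n)
    (hk : k = ⌊Real.logb ((δ : ℝ) / (r : ℝ)) (n : ℝ)⌋₊ + 1) : n * r ^ k < δ ^ k := by
  have hr' : (0 : ℝ) < r := by exact_mod_cast hr
  have hb : 1 < (δ : ℝ) / r := (one_lt_div hr').mpr (by exact_mod_cast hrδ)
  have h := Nat.lt_floor_add_one (Real.logb ((δ : ℝ) / (r : ℝ)) (n : ℝ))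
  rw [Real.logb_lt_iff_lt_rpow hb (by exact_mod_cast hn)] at h
  have h' : (n : ℝ) < ((δ : ℝ) / r) ^ k := by
    rw [hk, ← Real.rpow_natCast]
    exact_mod_cast h
  rw [div_pow, lt_div_iff₀ (by positivity)] at h'
  exact_mod_cast h'

theorem rounds_le {n δ r : ℕ} (hr : 0 < r) (hrδ : r < δ) :
    ((rounds ⟨n, δ, r⟩ : ℕ) : ℝ) ≤ 11 * Real.logb ((δ : ℝ) / (r : ℝ)) (n : ℝ) := by
  have hr' : (0 : ℝ) < r := by exact_mod_cast hr
  have hb : 1 < (δ : ℝ) / r := (one_lt_div hr').mpr (by exact_mod_cast hrδ)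
  have hlog : ∀ m : ℕ, 0 ≤ Real.logb ((δ : ℝ) / (r : ℝ)) (m : ℝ) := by
    rintro (_ | m)
    · simp
    · exact Real.logb_nonneg hb (by simp)
  by_cases h : n ≤ δ
  · simpa [rounds, h] using hlog n
  -- Since `n > δ ≥ δ / r`, the logarithm is at least 1 and absorbs the additive 7 in `4 * ⌊log⌋ +
  -- 7`; hence the constant 11.
  · have h1 : 1 ≤ Real.logb ((δ : ℝ) / (r : ℝ)) (n : ℝ) := by
      rw [Real.le_logb_iff_rpow_le hb (by exact_mod_cast (by omega : 0 < n)), Real.rpow_one]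
      refine (div_le_self (Nat.cast_nonneg _) (by exact_mod_cast hr)).trans ?_
      exact_mod_cast (not_le.mp h).le
    have h2 := Nat.floor_le (hlog n)
    simp only [rounds, radius, h, if_false]
    push_cast
    linarith

end BipartiteParams

/-! ### The global matching defined by all plans -/

namespace LocalNetwork

variable {V : Type*} {G : SimpleGraph V} [G.LocallyFinite] (N : LocalNetwork G)

/-- The plans proposed by all nodes. -/
def allPlans (r D : ℕ) : Set MatchingPlan :=
  {c | ∃ x, c ∈ proposal r (N.ballFacts D x) (N.ident x)}

/-- Plans reach at most `D + 1` from their center, so `v` hears of every plan affecting a node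
within distance `j`. -/
theorem mem_ballPlans_iff {r D j : ℕ} {v w : V} (hvw : G.Near j v w) {c : MatchingPlan}
    (hc : N.ident w ∈ c.left) : c ∈ N.ballPlans r D (D + 1 + j) v ↔ c ∈ N.allPlans r D := by
  constructor
  · rintro ⟨x, -, h⟩
    exact ⟨x, h⟩
  · rintro ⟨x, h⟩
    obtain ⟨p, hp⟩ := hvw
    obtain ⟨q, hq⟩ := h.1.near_of_mem_left hc
    exact ⟨x, ⟨p.append q, by rw [Walk.length_append]; omega⟩, h⟩

/-- Each node proposes at most one plan, the one fixed by `Classical.epsilon`, so the smallest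
center determines the plan. -/
theorem eq_of_center_eq {r D : ℕ} {c c' : MatchingPlan} (hc : c ∈ N.allPlans r D)
    (hc' : c' ∈ N.allPlans r D) (h : c.center = c'.center) : c = c' := by
  obtain ⟨x, hx, hcx⟩ := hc
  obtain ⟨x', hx', hcx'⟩ := hc'
  obtain rfl : x = x' := N.ident_injective (by rw [← hx.center_eq, h, hx'.center_eq])
  rw [hcx, hcx']

theorem exists_mem_proposal [Fintype V] {L R : Set V} {δ r k : ℕ} (hG : G.IsBipartiteWith L R)
    (hL : ∀ v ∈ L, δ ≤ G.degree v) (hR : ∀ v ∈ R, G.degree v ≤ r) (hδ : 0 < δ)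
    (hk : Fintype.card V * r ^ k < δ ^ k) {w : V} (hw : w ∈ L) :
    ∃ c ∈ N.allPlans r (2 * k), N.ident w ∈ c.left := by
  classical
  obtain ⟨U, hU, hwU, f, hf, hfU⟩ := hG.exists_absorbs_near hL hR hδ hk hw
  simp only [Finset.sdiff_empty] at hf hfU
  have : Nonempty V := ⟨w⟩
  have hinv : ∀ x, Function.invFun N.ident (N.ident x) = x :=
    Function.leftInverse_invFun N.ident_injective
  -- The absorbing set `U` and its injection `f`, transported along the identifiers.
  have hvalid : IsValid r (N.ballFacts (2 * k) w) (N.ident w)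
      ⟨N.ident w, N.ident '' G.nbrs U, N.ident '' U,
        fun a => N.ident (f (Function.invFun N.ident a))⟩ := by
    refine ⟨rfl, ⟨w, hwU, rfl⟩, ?_, ?_, ?_⟩
    · rintro _ ⟨u, hu, rfl⟩
      refine ⟨_, ⟨u, (hU u hu).2, rfl⟩, (N.card_fact_snd u).trans_le (hR u (hU u hu).1), ?_⟩
      intro x hx
      obtain ⟨y, hy, rfl⟩ := N.mem_fact_snd.mp hx
      exact ⟨y, mem_nbrs.mpr ⟨u, hu, hy⟩, rfl⟩
    · rintro _ ⟨v, hv, rfl⟩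
      obtain ⟨h1, h2⟩ := hfU v hv
      dsimp only
      rw [hinv]
      exact ⟨⟨_, h1, rfl⟩, _, ⟨f v, (hU _ h1).2, rfl⟩, N.mem_fact_snd.mpr ⟨v, h2.symm, rfl⟩⟩
    · rintro _ ⟨a, ha, rfl⟩ _ ⟨b, hb, rfl⟩ hab
      dsimp only at hab
      rw [hinv, hinv] at hab
      rw [hf ha hb (N.ident_injective hab)]
  have hspec := Classical.epsilon_spec
    (p := IsValid r (N.ballFacts (2 * k) w) (N.ident w)) ⟨_, hvalid⟩
  exact ⟨_, ⟨w, hspec, rfl⟩, hspec.center_mem⟩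

/-- Node `v` is matched to `w` by the plan that decides on `v`. -/
def Matched (r D : ℕ) (v w : V) : Prop := Assigns (N.allPlans r D) (N.ident v) (N.ident w)

variable {N} {r D : ℕ}

theorem Matched.adj {v w : V} (h : N.Matched r D v w) : G.Adj v w := by
  obtain ⟨c, ⟨x, hx, -⟩, hv, hw, -⟩ := h
  obtain ⟨y, hy, -, hvy, -⟩ := hx.exists_mate hv
  rwa [N.ident_injective (hw.symm.trans hy)]

/-- Nodes are not told their side. The degree test in `IsValid` replaces this: as `r < δ`, a mate
cannot lie in `L`. -/
theorem Matched.degree_le {v w : V} (h : N.Matched r D v w) : G.degree w ≤ r := by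
  obtain ⟨c, ⟨x, hx, -⟩, hv, hw, -⟩ := h
  obtain ⟨y, hy, -, -, -, hd⟩ := hx.exists_mate hv
  rwa [N.ident_injective (hw.symm.trans hy)]

theorem Matched.right_unique {v w w' : V} (h : N.Matched r D v w) (h' : N.Matched r D v w') :
    w = w' := by
  obtain ⟨c, hc, hv, hw, hm⟩ := h
  obtain ⟨c', hc', hv', hw', hm'⟩ := h'
  obtain rfl := N.eq_of_center_eq hc hc' (le_antisymm (hm c' hc' hv') (hm' c hc hv))
  exact N.ident_injective (hw.symm.trans hw')

theorem Matched.left_unique {v v' w : V} (h : N.Matched r D v w) (h' : N.Matched r D v' w) :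
    v = v' := by
  -- A plan sending `v` to `w` covers all neighbors of `w`, among them `v'`. So each deciding plan
  -- competes for both nodes, and the two centers agree.
  have key : ∀ {v v' : V} {c : MatchingPlan}, c ∈ N.allPlans r D → N.ident v ∈ c.left →
      c.mate (N.ident v) = N.ident w → N.Matched r D v' w → N.ident v' ∈ c.left := by
    rintro v v' c ⟨x, hx, -⟩ hv hw h'
    obtain ⟨y, hy, -, -, hyr, -⟩ := hx.exists_mate hv
    obtain rfl := N.ident_injective (hw.symm.trans hy)
    obtain ⟨y, hy, -, -, hcl⟩ := hx.exists_of_mem_right hyr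
    obtain rfl := N.ident_injective hy
    exact hcl _ h'.adj.symm
  obtain ⟨c, hc, hv, hw, hm⟩ := id h
  obtain ⟨c', hc', hv', hw', hm'⟩ := id h'
  obtain rfl := N.eq_of_center_eq hc hc'
    (le_antisymm (hm c' hc' (key hc' hv' hw' h)) (hm' c hc (key hc hv hw h')))
  obtain ⟨x, hx, -⟩ := hc
  exact N.ident_injective (hx.injOn hv hv' (hw.trans hw'.symm))

theorem exists_matched_of_mem_left {v : V} (h : ∃ c ∈ N.allPlans r D, N.ident v ∈ c.left) :
    ∃ w, N.Matched r D v w := by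
  classical
  have hex : ∃ m, ∃ c ∈ N.allPlans r D, N.ident v ∈ c.left ∧ c.center = m :=
    let ⟨c, hc, hv⟩ := h
    ⟨_, c, hc, hv, rfl⟩
  obtain ⟨c, hc, hv, hm⟩ := Nat.find_spec hex
  obtain ⟨x, hx, -⟩ := id hc
  obtain ⟨y, hy, -⟩ := hx.exists_mate hv
  exact ⟨y, c, hc, hv, hy, fun c' hc' hv' => hm.trans_le (Nat.find_le ⟨c', hc', hv', rfl⟩)⟩

variable (N r D) in
/-- The matching computed by the nodes. -/
def matching : G.Subgraph where
  verts := {v | ∃ w, N.Matched r D v w ∨ N.Matched r D w v}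
  Adj v w := N.Matched r D v w ∨ N.Matched r D w v
  adj_sub h := h.elim (fun h => h.adj) fun h => h.adj.symm
  edge_vert h := ⟨_, h⟩
  symm := ⟨fun _ _ h => h.symm⟩

theorem matching_adj_unique {L R : Set V} {δ : ℕ} (hG : G.IsBipartiteWith L R)
    (hL : ∀ v ∈ L, δ ≤ G.degree v) (hrδ : r < δ) {v w w' : V}
    (h : (N.matching r D).Adj v w) (h' : (N.matching r D).Adj v w') : w = w' := by
  have hR : ∀ {a b}, N.Matched r D a b → b ∈ R := by
    intro a b hab
    rcases hG.mem_of_adj hab.adj with h | h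
    · exact h.2
    · exact absurd (hL b h.2) (by have := hab.degree_le; omega)
  have hex : ∀ {a b c}, N.Matched r D a b → ¬ N.Matched r D c a := by
    intro a b c hab hca
    exact Set.disjoint_left.mp hG.disjoint (hG.symm.mem_of_mem_adj (hR hab) hab.adj.symm) (hR hca)
  rcases h with h | h <;> rcases h' with h' | h'
  · exact h.right_unique h'
  · exact absurd h' (hex h)
  · exact absurd h (hex h')
  · exact h.left_unique h'

theorem describesMatching_matching {out : (v : V) → Option (Fin (G.degree v))}
    (huniq : ∀ v w w', (N.matching r D).Adj v w → (N.matching r D).Adj v w' → w = w')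
    (hout : ∀ v i, out v = some i → (N.matching r D).Adj v (N.port v i))
    (hnone : ∀ v, out v = none → ∀ i, ¬ (N.matching r D).Adj v (N.port v i)) :
    DescribesMatching N out (N.matching r D) := by
  intro v w
  constructor
  · intro h
    obtain ⟨i, hi⟩ := (N.exists_port_iff (P := (N.matching r D).Adj v)).mpr ⟨w, h.adj_sub, h⟩
    cases ho : out v with
    | none => exact absurd hi (hnone v ho i)
    | some j => exact ⟨j, rfl, huniq v _ _ (hout v j ho) h⟩
  · rintro ⟨i, hi, rfl⟩
    exact hout v i hi

theorem assigns_iff_adj_matching {p : BipartiteParams} (hp : ¬ p.n ≤ p.δ) (v : V)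
    (i : Fin (G.degree v)) :
    let s := N.matchingState p p.rounds v
    (Assigns s.plans s.ident (s.nbrIdent i) ∨ Assigns s.plans (s.nbrIdent i) s.ident) ↔
      (N.matching p.r p.radius).Adj v (N.port v i) := by
  -- After `radius + 1` rounds the plans are made; they travel `radius + 1` steps to the nodes they
  -- cover, and one more to the neighbors of those.
  have hT : p.rounds = p.radius + (p.radius + 1 + 1) + 1 := by
    rw [BipartiteParams.rounds, if_neg hp]; ring
  dsimp only
  rw [N.matchingState_ident]
  rw [hT, N.nbrIdent_matchingState (by omega), N.plans_matchingState (by omega)]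
  refine or_congr (Assigns.congr fun c hc => ?_) (Assigns.congr fun c hc => ?_)
  · exact N.mem_ballPlans_iff (Near.refl 1 v) hc
  · exact N.mem_ballPlans_iff ((Near.refl 0 _).cons (N.port v i).2) hc

theorem describesMatching_partner {L R : Set V} {p : BipartiteParams} (hp : ¬ p.n ≤ p.δ)
    (hG : G.IsBipartiteWith L R) (hL : ∀ v ∈ L, p.δ ≤ G.degree v) (hrδ : p.r < p.δ) :
    DescribesMatching N (fun v => (N.matchingState p p.rounds v).partner)
      (N.matching p.r p.radius) := by
  refine describesMatching_matching (fun v w w' => matching_adj_unique hG hL hrδ) ?_ ?_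
  · intro v i hi
    rw [MatchingState.partner] at hi
    split_ifs at hi with h
    obtain rfl := Option.some.inj hi
    exact (assigns_iff_adj_matching hp v _).mp h.choose_spec
  · intro v hv i hi
    rw [MatchingState.partner] at hv
    split_ifs at hv with h
    exact h ⟨i, (assigns_iff_adj_matching hp v i).mpr hi⟩

end LocalNetwork

/-! ### The main theorem -/

theorem corollary1p7 :
    ∃ (A : LocalAlgorithm BipartiteParams (fun d => Option (Fin d))) (C : ℝ),
      ∀ (V : Type*) [Fintype V] (G : SimpleGraph V) [DecidableRel G.Adj] (L R : Set V) (δ r : ℕ),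
        G.IsBipartiteWith L R → L ∪ R = Set.univ →
        (∀ v ∈ L, δ ≤ G.degree v) → (∀ v ∈ R, G.degree v ≤ r) → 0 < r → r < δ →
        ∀ N : LocalNetwork G,
          ∃ (T : ℕ) (out : (v : V) → Option (Fin (G.degree v))) (M : G.Subgraph),
            (T : ℝ) ≤ C * Real.logb ((δ : ℝ) / (r : ℝ)) (Fintype.card V : ℝ) ∧
            A.OutputsWithin N ⟨Fintype.card V, δ, r⟩ T out ∧
            DescribesMatching N out M ∧
            IsMaximumMatching M ∧ L ⊆ M.verts := by
  refine ⟨matchingAlgorithm, 11, ?_⟩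
  intro V _ G _ L R δ r hG _ hL hR hr hrδ N
  set p : BipartiteParams := ⟨Fintype.card V, δ, r⟩ with hp
  have hround := BipartiteParams.rounds_le (n := Fintype.card V) hr hrδ
  have hout := N.outputsWithin_matchingAlgorithm p
  by_cases hn : p.n ≤ p.δ
  -- Degrees are below `n ≤ δ`, so `L` is empty and `G` has no edges; zero rounds suffice.
  · have hLe : ∀ v, v ∉ L := fun v hv =>
      absurd ((hL v hv).trans_lt (G.degree_lt_card_verts v)) (not_lt.mpr hn)
    have hE : ∀ v w, ¬ G.Adj v w := fun v w h =>
      (hG.mem_of_adj h).elim (fun h => hLe _ h.1) fun h => hLe _ h.2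
    have hM : ∀ M' : G.Subgraph, M'.edgeSet = ∅ := fun M' =>
      Set.eq_empty_of_forall_notMem fun e => by
        induction e with
        | _ a b => exact fun h => hE a b (M'.adj_sub h)
    refine ⟨_, _, ⊥, hround, hout, fun v w => ?_, ⟨fun v hv => hv.elim, fun M' _ => ?_⟩,
      fun v hv => absurd hv (hLe v)⟩
    · exact ⟨fun h => h.elim, fun ⟨i, _⟩ => absurd (N.port v i).2 (hE v _)⟩
    · rw [hM, hM]
  · have hsat : ∀ v ∈ L, ∃ w, N.Matched r p.radius v w := fun v hv =>
      LocalNetwork.exists_matched_of_mem_left (N.exists_mem_proposal hG hL hR (by omega)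
        (BipartiteParams.card_mul_pow_radius hr hrδ (Fintype.card_pos_iff.mpr ⟨v⟩) rfl) hv)
    choose! f hf using hsat
    refine ⟨_, _, N.matching r p.radius, hround, hout,
      LocalNetwork.describesMatching_partner hn hG hL hrδ, ⟨fun v hv => ?_, fun M' hM' => ?_⟩,
      fun v hv => ⟨f v, .inl (hf v hv)⟩⟩
    · obtain ⟨w, hw⟩ := hv
      exact ⟨w, hw, fun w' hw' => LocalNetwork.matching_adj_unique hG hL hrδ hw' hw⟩
    · exact (Subgraph.ncard_edgeSet_le hG hM').trans
        (Subgraph.le_ncard_edgeSet hG (f := f) fun v hv => .inl (hf v hv))
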